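/- Let $(X,\mathbf d)$ be a metric space and let $\mathcal C_X$ be the space of continuous curves $\gamma:\mathbb R_+\to X$ with the topology of uniform convergence on compact sets. For $X$ and $\mathcal C_X$, let $\mathcal P(\cdot)$ denote the set of Borel probability measures with the topology of weak convergence. For $t\ge 0$ let $e_t(\gamma)=\gamma(t)$, and write $e_{t\#}Q$ for the push-forward of $Q\in\mathcal P(\mathcal C_X)$ by $e_t$. Write $|\dot\gamma|(t)=\lim_{s\to t}\mathbf d(\gamma(s),\gamma(t))/|s-t|$ for the metric derivative of a curve, where this limit exists; for a Lipschitz curve it exists for almost every $t$. Let $\Gamma\subset X$, $g:\Gamma\to\mathbb R_+$, $K:\mathcal P(X)\times X\to\mathbb R_+$, $m_0\in\mathcal P(X)$, and assume: - (H1) there is $\mathbf 0\in X$ such that the closed ball $\overline B_X(\mathbf 0,R)$ is compact for every $R>0$; - (H2) $\Gamma$ is nonempty and closed; - (H3) $g$ is Lipschitz continuous with Lipschitz constant $L_g$; - (H4) there is $D>0$ such that for all $x,y\in X$ there are $T\in[0,D\,\mathbf d(x,y)]$ and a Lipschitz curve $\gamma:[0,T]\to X$ with $\gamma(0)=x$,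 $\gamma(T)=y$ and $|\dot\gamma|(t)=1$ for almost every $t\in[0,T]$; - (H8) $K$ is continuous and there are $K_{\min},K_{\max}>0$ with $K(\mu,x)\in[K_{\min},K_{\max}]$ for all $(\mu,x)\in\mathcal P(X)\times X$; - (H9) for every $R>0$ there is $L_R>0$ such that $|K(\mu,x_1)-K(\mu,x_2)|\le L_R\,\mathbf d(x_1,x_2)$ for all $\mu\in\mathcal P(X)$ and $x_1,x_2\in\overline B_X(\mathbf 0,R)$; - (H10) $L_gK_{\max}<1$. For $k:\mathbb R_+\times X\to\mathbb R_+$, let $\mathrm{Adm}(k)$ be the set of Lipschitz curves $\gamma:\mathbb R_+\to X$ with $|\dot\gamma|(t)\le k(t,\gamma(t))$ for almost every $t\ge 0$. For $\gamma\in\mathcal C_X$ and $t_0\ge 0$ put $\tau(t_0,\gamma)=\inf\{t\ge0 : \gamma(t+t_0)\in\Gamma\}$ (with $\inf\emptyset=+\infty$), and $G(t_0,\gamma)=g(\gamma(t_0+\tau(t_0,\gamma)))$ if $\tau(t_0,\gamma)<+\infty$, $G(t_0,\gamma)=+\infty$ otherwise. A curve $\gamma$ is *optimal for $(k,g,t_0,x_0)$*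 if $\gamma\in\mathrm{Adm}(k)$, $\gamma(t)=x_0$ for every $t\in[0,t_0]$, $\tau(t_0,\gamma)<+\infty$, $\gamma(t)=\gamma(t_0+\tau(t_0,\gamma))\in\Gamma$ for every $t\ge t_0+\tau(t_0,\gamma)$, and $$\tau(t_0,\gamma)+G(t_0,\gamma)=\min_{\beta\in\mathrm{Adm}(k),\ \beta(t_0)=x_0}\ \tau(t_0,\beta)+G(t_0,\beta).$$ Let $Q\in\mathcal P(\mathcal C_X)$ and put $k_Q(t,x)=K(e_{t\#}Q,x)$. The measure $Q$ is a *weak equilibrium* if $e_{0\#}Q=m_0$ and $Q$-almost every $\gamma$ is optimal for $(k_Q,g,0,\gamma(0))$; it is a *strong equilibrium* if $e_{0\#}Q=m_0$ and every $\gamma\in\operatorname{supp}(Q)$ is optimal for $(k_Q,g,0,\gamma(0))$. Then $Q$ is a weak equilibrium if and only if it is a strong equilibrium. -/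

import Mathlib

open MeasureTheory Set Filter Topology
open scoped NNReal ENNReal

noncomputable section

namespace ExitMFG

/-- The Borel `σ`-algebra of the space `C(ℝ₊, X)` of continuous curves, which Mathlib endows with
the compact-open topology, that is, the topology of uniform convergence on compact sets. -/
instance curveMeasurableSpace {X : Type*} [TopologicalSpace X] : MeasurableSpace C(ℝ≥0, X) :=
  borel _

instance curveBorelSpace {X : Type*} [TopologicalSpace X] : BorelSpace C(ℝ≥0, X) := ⟨rfl⟩

/-- `γ` has metric derivative `v` at time `t`:
`d(γ(s), γ(t)) / |s - t| → v` as `s → t`, `s ≠ t`. This depends only on `γ` near `t`. -/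
def HasMetricDerivAt {X : Type*} [PseudoMetricSpace X] (γ : ℝ → X) (t v : ℝ) : Prop :=
  Tendsto (fun s : ℝ => dist (γ s) (γ t) / |s - t|) (𝓝[≠] t) (𝓝 v)

/-- Any two points `x`, `y` are joined by a Lipschitz curve with metric derivative equal to `1`
almost everywhere, defined on an interval `[0, T]` with `T ≤ D d(x, y)`, where `D > 0` does not
depend on `x` and `y`. Only the values of `γ` on `[0, T]` matter. -/
def HasUnitSpeedConnections (X : Type*) [PseudoMetricSpace X] : Prop :=
  ∃ D : ℝ, 0 < D ∧ ∀ x y : X, ∃ T : ℝ, T ∈ Icc 0 (D * dist x y) ∧ ∃ γ : ℝ → X,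
    (∃ C : ℝ≥0, LipschitzOnWith C γ (Icc 0 T)) ∧ γ 0 = x ∧ γ T = y ∧
    ∀ᵐ t : ℝ, t ∈ Ioo 0 T → HasMetricDerivAt γ t 1

section OptimalControl

variable {X : Type*} [PseudoMetricSpace X]

/-- The set of `k`-admissible curves: Lipschitz continuous curves whose metric derivative (which
exists almost everywhere) is at most `k(t, γ(t))` for almost every `t > 0`. -/
def Adm (k : ℝ≥0 → X → ℝ≥0) : Set C(ℝ≥0, X) :=
  {γ | (∃ C : ℝ≥0, LipschitzWith C γ) ∧
    ∀ᵐ t : ℝ, 0 < t → ∃ v : ℝ, HasMetricDerivAt (fun s : ℝ => γ s.toNNReal) t v ∧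
      v ≤ (k t.toNNReal (γ t.toNNReal) : ℝ)}

/-- The first exit time after `t₀`: `τ(t₀, γ) = inf {t ≥ 0 | γ(t + t₀) ∈ Γ}`, with
`inf ∅ = ∞`. -/
def exitTime (Γ : Set X) (t₀ : ℝ≥0) (γ : C(ℝ≥0, X)) : ℝ≥0∞ :=
  ⨅ (t : ℝ≥0) (_ : γ (t + t₀) ∈ Γ), (t : ℝ≥0∞)

open Classical in
/-- The final cost: `g` at the first exit position, and `∞` if the curve never exits. -/
def finalCost (Γ : Set X) (g : X → ℝ≥0) (t₀ : ℝ≥0) (γ : C(ℝ≥0, X)) : ℝ≥0∞ :=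
  if exitTime Γ t₀ γ = ∞ then ∞ else (g (γ (t₀ + (exitTime Γ t₀ γ).toNNReal)) : ℝ≥0∞)

/-- The total cost `τ(t₀, γ) + G(t₀, γ)`. -/
def totalCost (Γ : Set X) (g : X → ℝ≥0) (t₀ : ℝ≥0) (γ : C(ℝ≥0, X)) : ℝ≥0∞ :=
  exitTime Γ t₀ γ + finalCost Γ g t₀ γ

/-- The set of optimal curves for `(k, g, t₀, x₀)`: admissible curves, equal to `x₀` on
`[0, t₀]`, that reach `Γ` in finite time, stay from then on at their arrival position, which
belongs to `Γ`, and minimize the total cost among all admissible curves `β` with `β(t₀) = x₀`. -/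
def Opt (Γ : Set X) (k : ℝ≥0 → X → ℝ≥0) (g : X → ℝ≥0) (t₀ : ℝ≥0) (x₀ : X) : Set C(ℝ≥0, X) :=
  {γ | γ ∈ Adm k ∧ (∀ t ≤ t₀, γ t = x₀) ∧ exitTime Γ t₀ γ < ∞ ∧
    (∀ t : ℝ≥0, t₀ + (exitTime Γ t₀ γ).toNNReal ≤ t →
      γ t = γ (t₀ + (exitTime Γ t₀ γ).toNNReal) ∧
      γ (t₀ + (exitTime Γ t₀ γ).toNNReal) ∈ Γ) ∧
    IsMinOn (totalCost Γ g t₀) {β | β ∈ Adm k ∧ β t₀ = x₀} γ}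

end OptimalControl

section Equilibria

variable {X : Type*} [MetricSpace X] [MeasurableSpace X] [BorelSpace X]

/-- The push-forward `e_{t#}Q` of `Q` under the evaluation `e_t(γ) = γ(t)`. -/
def evalMap (Q : ProbabilityMeasure C(ℝ≥0, X)) (t : ℝ≥0) : ProbabilityMeasure X :=
  Q.map (f := fun γ : C(ℝ≥0, X) => γ t) (continuous_eval_const t).aemeasurable

/-- The speed bound `k_Q(t, x) = K(e_{t#}Q, x)` induced by a distribution `Q` of curves. -/
def inducedSpeed (K : ProbabilityMeasure X → X → ℝ≥0) (Q : ProbabilityMeasure C(ℝ≥0, X)) :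
    ℝ≥0 → X → ℝ≥0 :=
  fun t x => K (evalMap Q t) x

/-- `Q` is a weak equilibrium: `e_{0#}Q = m₀` and `Q`-almost every `γ` is optimal for
`(k_Q, g, 0, γ(0))`. -/
def IsWeakEquilibrium (Γ : Set X) (K : ProbabilityMeasure X → X → ℝ≥0) (g : X → ℝ≥0)
    (m₀ : ProbabilityMeasure X) (Q : ProbabilityMeasure C(ℝ≥0, X)) : Prop :=
  evalMap Q 0 = m₀ ∧
    ∀ᵐ γ ∂(Q : Measure C(ℝ≥0, X)), γ ∈ Opt Γ (inducedSpeed K Q) g 0 (γ 0)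

/-- `Q` is a strong equilibrium: `e_{0#}Q = m₀` and every `γ ∈ supp Q` is optimal for
`(k_Q, g, 0, γ(0))`. -/
def IsStrongEquilibrium (Γ : Set X) (K : ProbabilityMeasure X → X → ℝ≥0) (g : X → ℝ≥0)
    (m₀ : ProbabilityMeasure X) (Q : ProbabilityMeasure C(ℝ≥0, X)) : Prop :=
  evalMap Q 0 = m₀ ∧
    ∀ γ ∈ (Q : Measure C(ℝ≥0, X)).support, γ ∈ Opt Γ (inducedSpeed K Q) g 0 (γ 0)

end Equilibria

end ExitMFG

end

/-!
The curves that are optimal for the speed bound `k = k_Q`, over all initial points, form a closed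
set (`isClosed_setOf_mem_Opt`). A closed set of full measure contains the support, which gives one
implication; the other holds because `C(ℝ≥0, X)` is second countable, so that the support has full
measure.

Three facts carry the closedness.

* A curve is admissible if and only if `d(γ(s), γ(t)) ≤ ∫ k(r, γ(r)) dr` over `[s, t]` for all
  `s ≤ t` (`dist_le_integral_of_mem_Adm`, `mem_Adm_of_dist_le_integral`), a condition that survives
  locally uniform limits. The converse direction needs the metric Rademacher theorem in dimension
  one, `LipschitzWith.ae_exists_hasMetricDerivAt`.
* The value of the control problem is upper semicontinuous in the initial point: an admissible curve
  from `x₀` is imitated from every nearby point with a small loss of time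
  (`exists_mem_Adm_imitating`). Since `k` is merely continuous in time, slowing the curve down by a
  constant factor is not enough; an explicit subsolution of the equation for the time change is used
  instead, which exists because `k` is locally Lipschitz in space.
* As `Lg * Kmax < 1`, leaving at the first visit to `Γ` is strictly better than leaving at a later
  one (`cost_le_of_le`), so the limit of the exit times is the exit time of the limit curve.
-/

namespace ExitMFG

/-! ### Lipschitz curves and their metric derivatives -/

section MetricDerivative

variable {X : Type*} [PseudoMetricSpace X]

lemma abs_slope_dist_le (f : ℝ → X) (x : X) (r s : ℝ) :
    |slope (fun u => dist (f u) x) r s| ≤ dist (f s) (f r) / |s - r| := by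
  rw [slope_def_field, abs_div]
  gcongr
  exact abs_dist_sub_le _ _ _

lemma HasMetricDerivAt.abs_deriv_dist_le {f : ℝ → X} {r v φ' : ℝ} (h : HasMetricDerivAt f r v)
    {x : X} (hφ : HasDerivAt (fun u => dist (f u) x) φ' r) : |φ'| ≤ v :=
  le_of_tendsto_of_tendsto' (hasDerivAt_iff_tendsto_slope.1 hφ).abs h
    fun s => abs_slope_dist_le f x r s

/-- A Lipschitz curve is no longer than the integral of any bound on its metric derivative: apply
the fundamental theorem of calculus to the distance to the initial point. -/
lemma dist_le_integral_of_metricDeriv_le {f : ℝ → X} {a b : ℝ} (hab : a ≤ b) {C : ℝ≥0}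
    (hf : LipschitzOnWith C f (Icc a b)) {m : ℝ → ℝ} (hm : IntervalIntegrable m volume a b)
    (h : ∀ᵐ r : ℝ, r ∈ Ioo a b → ∃ v, HasMetricDerivAt f r v ∧ v ≤ m r) :
    dist (f a) (f b) ≤ ∫ r in a..b, m r := by
  have hac : AbsolutelyContinuousOnInterval (fun r => dist (f r) (f a)) a b := by
    refine LipschitzOnWith.absolutelyContinuousOnInterval (K := C) ?_
    rw [uIcc_of_le hab]
    refine LipschitzOnWith.of_dist_le_mul fun r hr s hs => ?_
    exact (abs_dist_sub_le _ _ _).trans (hf.dist_le_mul r hr s hs)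
  have hderiv : ∀ᵐ r ∂volume.restrict (Icc a b),
      deriv (fun u => dist (f u) (f a)) r ≤ m r := by
    rw [← restrict_Ioo_eq_restrict_Icc, ae_restrict_iff' measurableSet_Ioo]
    filter_upwards [h, hac.ae_differentiableAt] with r hr hd hrab
    obtain ⟨v, hv, hvm⟩ := hr hrab
    have hd' := (hd (by rw [uIcc_of_le hab]; exact Ioo_subset_Icc_self hrab)).hasDerivAt
    exact (le_abs_self _).trans ((hv.abs_deriv_dist_le hd').trans hvm)
  have key := intervalIntegral.integral_mono_ae_restrict hab hac.intervalIntegrable_deriv hm hderiv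
  rw [hac.integral_deriv_eq_sub] at key
  simpa [dist_comm] using key

/-- A Lipschitz curve in a separable metric space has a metric derivative almost everywhere. It is
the supremum of the `|φₙ'|`, where `φₙ` is the distance to the `n`-th point of a dense sequence. -/
lemma _root_.LipschitzWith.ae_exists_hasMetricDerivAt [TopologicalSpace.SeparableSpace X]
    {f : ℝ → X} {C : ℝ≥0} (hf : LipschitzWith C f) :
    ∀ᵐ t : ℝ, ∃ v, HasMetricDerivAt f t v := by
  have hne : Nonempty X := ⟨f 0⟩
  let x := TopologicalSpace.denseSeq X
  let φ : ℕ → ℝ → ℝ := fun n t => dist (f t) (x n)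
  have hφ : ∀ n, LipschitzWith C (φ n) := fun n => by
    refine LipschitzWith.of_dist_le_mul fun r s => ?_
    exact (abs_dist_sub_le _ _ _).trans (hf.dist_le_mul r s)
  have hC : ∀ n t, |deriv (φ n) t| ≤ C := fun n t => norm_deriv_le_of_lipschitz (hφ n)
  let m : ℝ → ℝ := fun t => ⨆ n, |deriv (φ n) t|
  have hbdd : ∀ t, BddAbove (range fun n => |deriv (φ n) t|) := fun t =>
    ⟨C, by rintro _ ⟨n, rfl⟩; exact hC n t⟩
  have hle : ∀ n t, |deriv (φ n) t| ≤ m t := fun n t => le_ciSup (hbdd t) n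
  have hm0 : ∀ t, 0 ≤ m t := fun t => (abs_nonneg _).trans (hle 0 t)
  have hmC : ∀ t, m t ≤ C := fun t => ciSup_le fun n => hC n t
  have hmmeas : Measurable m := Measurable.iSup fun n => (measurable_deriv (φ n)).norm
  have hmint : LocallyIntegrable m volume := by
    refine (locallyIntegrable_const (C : ℝ)).mono hmmeas.aestronglyMeasurable ?_
    refine Eventually.of_forall fun t => ?_
    simpa [abs_of_nonneg (hm0 t)] using hmC t
  have hmi : ∀ a b, IntervalIntegrable m volume a b := fun a b =>
    (hmint.integrableOn_isCompact isCompact_uIcc).intervalIntegrable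
  have hdist_le : ∀ a b, a ≤ b → dist (f a) (f b) ≤ ∫ r in a..b, m r := by
    intro a b hab
    have hn : ∀ n, φ n b - φ n a ≤ ∫ r in a..b, m r := by
      intro n
      have hac : AbsolutelyContinuousOnInterval (φ n) a b :=
        ((hφ n).lipschitzOnWith (s := uIcc a b)).absolutelyContinuousOnInterval
      rw [← hac.integral_deriv_eq_sub]
      exact intervalIntegral.integral_mono hab hac.intervalIntegrable_deriv (hmi a b)
        fun r => (le_abs_self _).trans (hle n r)
    have hcl : IsClosed {y | dist (f b) y - dist (f a) y ≤ ∫ r in a..b, m r} :=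
      isClosed_le (by fun_prop) continuous_const
    have hall : dist (f b) (f a) - dist (f a) (f a) ≤ ∫ r in a..b, m r :=
      (TopologicalSpace.denseRange_denseSeq X).induction_on
        (p := fun y => dist (f b) y - dist (f a) y ≤ ∫ r in a..b, m r) (f a) hcl hn
    simpa [dist_comm] using hall
  have habs : ∀ t s, dist (f s) (f t) ≤ |∫ r in t..s, m r| := by
    intro t s
    rcases le_total t s with h | h
    · rw [dist_comm]
      exact (hdist_le t s h).trans (le_abs_self _)
    · rw [intervalIntegral.integral_symm, abs_neg]
      exact (hdist_le s t h).trans (le_abs_self _)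
  filter_upwards [_root_.LocallyIntegrable.ae_hasDerivAt_integral hmint,
    ae_all_iff.2 fun n => (hφ n).ae_differentiableAt_real] with t ht hdiff
  refine ⟨m t, ?_⟩
  have hup : Tendsto (fun s => |∫ r in t..s, m r| / |s - t|) (𝓝[≠] t) (𝓝 (m t)) := by
    have h := (hasDerivAt_iff_tendsto_slope.1 (ht t)).abs
    rw [abs_of_nonneg (hm0 t)] at h
    refine h.congr fun s => ?_
    simp [slope_def_field, abs_div]
  refine tendsto_order.2 ⟨fun c hc => ?_, fun c hc => ?_⟩
  · obtain ⟨n, hn⟩ := exists_lt_of_lt_ciSup hc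
    have hd := (hasDerivAt_iff_tendsto_slope.1 (hdiff n).hasDerivAt).abs
    filter_upwards [hd.eventually (lt_mem_nhds hn)] with s hs
    exact hs.trans_le (abs_slope_dist_le f (x n) t s)
  · filter_upwards [hup.eventually (gt_mem_nhds hc)] with s hs
    exact (div_le_div_of_nonneg_right (habs t s) (abs_nonneg _)).trans_lt hs

end MetricDerivative

/-! ### Integral characterization of admissible curves -/

section Admissible

variable {X : Type*} [PseudoMetricSpace X] {k : ℝ≥0 → X → ℝ≥0}

/-- The speed bound `r ↦ k(r, γ(r))` along a curve, extended to negative times by its value at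
`0`. -/
noncomputable def speedAlong (k : ℝ≥0 → X → ℝ≥0) (γ : C(ℝ≥0, X)) (r : ℝ) : ℝ :=
  k r.toNNReal (γ r.toNNReal)

lemma continuous_uncurry_speedAlong (hk : Continuous (Function.uncurry k)) :
    Continuous (Function.uncurry (speedAlong k)) := by
  have h : Continuous fun p : C(ℝ≥0, X) × ℝ => (p.2.toNNReal, p.1 p.2.toNNReal) := by fun_prop
  exact NNReal.continuous_coe.comp (hk.comp h)

lemma continuous_speedAlong (hk : Continuous (Function.uncurry k)) (γ : C(ℝ≥0, X)) :
    Continuous (speedAlong k γ) :=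
  (continuous_uncurry_speedAlong hk).uncurry_left γ

lemma integral_speedAlong_le (hk : Continuous (Function.uncurry k)) {Kmax : ℝ≥0}
    (hmax : ∀ t x, k t x ≤ Kmax) (γ : C(ℝ≥0, X)) {s t : ℝ} (hst : s ≤ t) :
    ∫ r in s..t, speedAlong k γ r ≤ Kmax * (t - s) := by
  have h := intervalIntegral.integral_mono_on hst
    ((continuous_speedAlong hk γ).intervalIntegrable s t)
    (intervalIntegrable_const (μ := volume) (c := (Kmax : ℝ)))
    fun r _ => NNReal.coe_le_coe.2 (hmax r.toNNReal (γ r.toNNReal))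
  simpa [mul_comm] using h

lemma le_integral_speedAlong (hk : Continuous (Function.uncurry k)) {Kmin : ℝ≥0}
    (hmin : ∀ t x, Kmin ≤ k t x) (γ : C(ℝ≥0, X)) {s t : ℝ} (hst : s ≤ t) :
    Kmin * (t - s) ≤ ∫ r in s..t, speedAlong k γ r := by
  have h := intervalIntegral.integral_mono_on hst
    (intervalIntegrable_const (μ := volume) (c := (Kmin : ℝ)))
    ((continuous_speedAlong hk γ).intervalIntegrable s t)
    fun r _ => NNReal.coe_le_coe.2 (hmin r.toNNReal (γ r.toNNReal))
  simpa [mul_comm] using h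

lemma dist_le_integral_of_mem_Adm (hk : Continuous (Function.uncurry k)) {γ : C(ℝ≥0, X)}
    (hγ : γ ∈ Adm k) {s t : ℝ≥0} (hst : s ≤ t) :
    dist (γ s) (γ t) ≤ ∫ r in (s : ℝ)..t, speedAlong k γ r := by
  obtain ⟨⟨C, hC⟩, hae⟩ := hγ
  have hlip : LipschitzWith C fun r : ℝ => γ r.toNNReal := by
    simpa [Function.comp_def] using hC.comp Real.lipschitzWith_toNNReal
  have h := dist_le_integral_of_metricDeriv_le (NNReal.coe_le_coe.2 hst)
    (hlip.lipschitzOnWith (s := Icc (s : ℝ) t))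
    ((continuous_speedAlong hk γ).intervalIntegrable s t)
    (hae.mono fun r hr hrst => hr (s.coe_nonneg.trans_lt hrst.1))
  simpa using h

/-- A curve dominated by the integral of its speed bound is admissible: its metric derivative, where
it exists, is bounded by the derivative of that integral. -/
lemma mem_Adm_of_dist_le_integral [TopologicalSpace.SeparableSpace X]
    (hk : Continuous (Function.uncurry k)) {Kmax : ℝ≥0} (hmax : ∀ t x, k t x ≤ Kmax)
    {γ : C(ℝ≥0, X)}
    (hγ : ∀ s t : ℝ≥0, s ≤ t → dist (γ s) (γ t) ≤ ∫ r in (s : ℝ)..t, speedAlong k γ r) :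
    γ ∈ Adm k := by
  have hlip : LipschitzWith Kmax γ := by
    refine LipschitzWith.of_dist_le_mul fun s t => ?_
    wlog hst : s ≤ t generalizing s t
    · rw [dist_comm (γ s), dist_comm s]
      exact this t s (le_of_not_ge hst)
    refine (hγ s t hst).trans ((integral_speedAlong_le hk hmax γ hst).trans_eq ?_)
    rw [dist_comm, NNReal.dist_eq, abs_of_nonneg (sub_nonneg.2 (NNReal.coe_le_coe.2 hst))]
    rfl
  refine ⟨⟨Kmax, hlip⟩, ?_⟩
  have hlip' : LipschitzWith Kmax fun r : ℝ => γ r.toNNReal := by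
    simpa [Function.comp_def] using hlip.comp Real.lipschitzWith_toNNReal
  filter_upwards [hlip'.ae_exists_hasMetricDerivAt] with t ht ht0
  obtain ⟨v, hv⟩ := ht
  refine ⟨v, hv, ?_⟩
  have hcont := continuous_speedAlong hk γ
  have hslope : Tendsto (slope (fun u => ∫ r in t..u, speedAlong k γ r) t) (𝓝[≠] t)
      (𝓝 (speedAlong k γ t)) :=
    hasDerivAt_iff_tendsto_slope.1 (intervalIntegral.integral_hasDerivAt_right
      (hcont.intervalIntegrable t t) (hcont.stronglyMeasurableAtFilter _ _) hcont.continuousAt)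
  have hle : 𝓝[>] t ≤ 𝓝[≠] t := nhdsWithin_mono _ fun s hs => ne_of_gt hs
  refine le_of_tendsto_of_tendsto (hv.mono_left hle) (hslope.mono_left hle) ?_
  filter_upwards [self_mem_nhdsWithin] with s hs
  have hs' : t < s := hs
  have h := hγ t.toNNReal s.toNNReal (Real.toNNReal_le_toNNReal hs'.le)
  rw [Real.coe_toNNReal t ht0.le, Real.coe_toNNReal s (ht0.trans hs').le] at h
  rw [slope_def_field, intervalIntegral.integral_same, sub_zero, abs_of_pos (sub_pos.2 hs'),
    dist_comm]
  exact div_le_div_of_nonneg_right h (sub_pos.2 hs').le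

lemma dist_le_of_mem_Adm (hk : Continuous (Function.uncurry k)) {Kmax : ℝ≥0}
    (hmax : ∀ t x, k t x ≤ Kmax) {γ : C(ℝ≥0, X)} (hγ : γ ∈ Adm k) {s t : ℝ≥0} (hst : s ≤ t) :
    dist (γ s) (γ t) ≤ Kmax * (t - s) :=
  (dist_le_integral_of_mem_Adm hk hγ hst).trans (integral_speedAlong_le hk hmax γ hst)

lemma isClosed_Adm [SecondCountableTopology X]
    (hk : Continuous (Function.uncurry k)) {Kmax : ℝ≥0} (hmax : ∀ t x, k t x ≤ Kmax) :
    IsClosed (Adm k) := by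
  have heq : Adm k = ⋂ (s : ℝ≥0) (t : ℝ≥0) (_ : s ≤ t),
      {γ | dist (γ s) (γ t) ≤ ∫ r in (s : ℝ)..t, speedAlong k γ r} := by
    ext γ
    simp only [mem_iInter]
    exact ⟨fun h s t hst => dist_le_integral_of_mem_Adm hk h hst,
      fun h => mem_Adm_of_dist_le_integral hk hmax h⟩
  rw [heq]
  refine isClosed_iInter fun s => isClosed_iInter fun t => isClosed_iInter fun _ => ?_
  exact isClosed_le (by fun_prop)
    (intervalIntegral.continuous_parametric_intervalIntegral_of_continuous'
      (continuous_uncurry_speedAlong hk) _ _)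

lemma dist_le_sub_of_glue {w : ℝ≥0 → X} {E : ℝ≥0 → ℝ} {δ : ℝ≥0}
    (h₁ : ∀ s t, s ≤ t → t ≤ δ → dist (w s) (w t) ≤ E t - E s)
    (h₂ : ∀ s t, δ ≤ s → s ≤ t → dist (w s) (w t) ≤ E t - E s) (s t : ℝ≥0) (hst : s ≤ t) :
    dist (w s) (w t) ≤ E t - E s := by
  rcases le_total t δ with ht | ht
  · exact h₁ s t hst ht
  rcases le_total δ s with hs | hs
  · exact h₂ s t hs hst
  linarith [dist_triangle (w s) (w δ) (w t), h₁ s δ hs le_rfl, h₂ δ t le_rfl ht]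

/-- A path that moves with speed at most `Kmin` on `[0, δ]` and at most `m` on `[δ, b]`, where `m`
respects the speed bound along the path, agrees at the times `0` and `b` with an admissible curve:
stop it at time `b`. -/
lemma exists_mem_Adm_of_path [TopologicalSpace.SeparableSpace X]
    (hk : Continuous (Function.uncurry k)) {Kmin Kmax : ℝ≥0} (hmin : ∀ t x, Kmin ≤ k t x)
    (hmax : ∀ t x, k t x ≤ Kmax) {w : ℝ≥0 → X} {δ b : ℝ≥0} (hδb : δ ≤ b) {m : ℝ → ℝ}
    (hm : Continuous m)
    (h₁ : ∀ s t, s ≤ t → t ≤ δ → dist (w s) (w t) ≤ Kmin * (t - s))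
    (h₂ : ∀ s t, δ ≤ s → s ≤ t → t ≤ b → dist (w s) (w t) ≤ ∫ r in (s : ℝ)..t, m r)
    (hmk : ∀ r, δ ≤ r → r ≤ b → m r ≤ k r (w r)) :
    ∃ γ ∈ Adm k, γ 0 = w 0 ∧ γ b = w b := by
  -- The gluing is done twice, since integrating the speed along the path needs its continuity.
  have glue : ∀ E : ℝ≥0 → ℝ, Monotone E →
      (∀ s t, s ≤ t → t ≤ δ → Kmin * (t - s) ≤ E t - E s) →
      (∀ s t : ℝ≥0, δ ≤ s → s ≤ t → t ≤ b → ∫ r in (s : ℝ)..t, m r ≤ E t - E s) →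
      ∀ s t, s ≤ t → dist (w (min s b)) (w (min t b)) ≤ E t - E s := by
    intro E hE hE₁ hE₂
    refine dist_le_sub_of_glue (δ := b) (w := fun t => w (min t b)) ?_ ?_
    · intro s t hst htb
      have hall := dist_le_sub_of_glue (w := fun t => w (min t b)) (E := fun t => E (min t b))
        (δ := δ) ?_ ?_ s t hst
      · simpa [min_eq_left htb, min_eq_left (hst.trans htb)] using hall
      · intro s t hst ht
        simp only [min_eq_left (ht.trans hδb), min_eq_left (hst.trans (ht.trans hδb))]
        exact (h₁ s t hst ht).trans (hE₁ s t hst ht)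
      · intro s t hs hst
        have hs' : δ ≤ min s b := le_min hs hδb
        have hst' : min s b ≤ min t b := min_le_min_right _ hst
        exact (h₂ _ _ hs' hst' (min_le_right _ _)).trans (hE₂ _ _ hs' hst' (min_le_right _ _))
    · intro s t hs hst
      simp only [min_eq_right hs, min_eq_right (hs.trans hst), dist_self]
      exact sub_nonneg.2 (hE hst)
  have hmK : ∀ s t : ℝ≥0, δ ≤ s → s ≤ t → t ≤ b →
      ∫ r in (s : ℝ)..t, m r ≤ Kmax * (t - s) := by
    intro s t hs hst ht
    have h := intervalIntegral.integral_mono_on (NNReal.coe_le_coe.2 hst)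
      (hm.intervalIntegrable s t) (intervalIntegrable_const (μ := volume) (c := (Kmax : ℝ)))
      fun r hr => by
        lift r to ℝ≥0 using s.coe_nonneg.trans hr.1
        have hr₁ : s ≤ r := NNReal.coe_le_coe.1 hr.1
        have hr₂ : r ≤ t := NNReal.coe_le_coe.1 hr.2
        exact (hmk r (hs.trans hr₁) (hr₂.trans ht)).trans (NNReal.coe_le_coe.2 (hmax _ _))
    simpa [mul_comm] using h
  have hlip : LipschitzWith Kmax fun t => w (min t b) := by
    refine LipschitzWith.of_dist_le_mul fun s t => ?_
    wlog hst : s ≤ t generalizing s t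
    · rw [dist_comm (w _), dist_comm s]
      exact this t s (le_of_not_ge hst)
    have hst' : (0 : ℝ) ≤ t - s := sub_nonneg.2 (NNReal.coe_le_coe.2 hst)
    have h := glue (fun t => Kmax * t)
      (fun s t h => mul_le_mul_of_nonneg_left (NNReal.coe_le_coe.2 h) Kmax.coe_nonneg)
      (fun s t hst _ => by
        rw [← mul_sub]
        exact mul_le_mul_of_nonneg_right
          (NNReal.coe_le_coe.2 ((hmin 0 (w 0)).trans (hmax 0 (w 0))))
          (sub_nonneg.2 (NNReal.coe_le_coe.2 hst)))
      (fun s t hs hst ht => by rw [← mul_sub]; exact hmK s t hs hst ht) s t hst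
    rw [dist_comm s, NNReal.dist_eq, abs_of_nonneg hst', mul_sub]
    exact h
  let γ : C(ℝ≥0, X) := ⟨fun t => w (min t b), hlip.continuous⟩
  refine ⟨γ, mem_Adm_of_dist_le_integral hk hmax fun s t hst => ?_, by simp [γ], by simp [γ]⟩
  have hint : ∀ s t : ℝ, IntervalIntegrable (speedAlong k γ) volume s t := fun s t =>
    (continuous_speedAlong hk γ).intervalIntegrable s t
  have hsub : ∀ s t : ℝ≥0, (∫ r in (0 : ℝ)..t, speedAlong k γ r) -
      ∫ r in (0 : ℝ)..s, speedAlong k γ r = ∫ r in (s : ℝ)..t, speedAlong k γ r := fun s t =>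
    intervalIntegral.integral_interval_sub_left (hint 0 t) (hint 0 s)
  have hlow := fun (s t : ℝ≥0) (hst : s ≤ t) =>
    le_integral_speedAlong hk hmin γ (NNReal.coe_le_coe.2 hst)
  refine (glue (fun t => ∫ r in (0 : ℝ)..t, speedAlong k γ r) ?_ ?_ ?_ s t hst).trans_eq (hsub s t)
  · intro s t hst
    have h0 : (0 : ℝ) ≤ Kmin * (t - s) :=
      mul_nonneg Kmin.coe_nonneg (sub_nonneg.2 (NNReal.coe_le_coe.2 hst))
    exact sub_nonneg.1 ((h0.trans (hlow s t hst)).trans_eq (hsub s t).symm)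
  · intro s t hst _
    rw [hsub]
    exact hlow s t hst
  · intro s t hs hst ht
    rw [hsub]
    refine intervalIntegral.integral_mono_on (NNReal.coe_le_coe.2 hst)
      (hm.intervalIntegrable s t) (hint s t) fun r hr => ?_
    lift r to ℝ≥0 using s.coe_nonneg.trans hr.1
    have hr₁ : s ≤ r := NNReal.coe_le_coe.1 hr.1
    have hr₂ : r ≤ b := (NNReal.coe_le_coe.1 hr.2).trans ht
    simpa [speedAlong, γ, min_eq_left hr₂] using hmk r (hs.trans hr₁) hr₂

end Admissible

/-! ### Comparison of costs from nearby initial points -/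

section Perturbation

variable {X : Type*} [PseudoMetricSpace X] {k : ℝ≥0 → X → ℝ≥0}

/-- Two points are joined by a path of speed at most `c` in a time at most proportional to their
distance. -/
lemma HasUnitSpeedConnections.exists_path (h : HasUnitSpeedConnections X) {c : ℝ≥0} (hc : 0 < c) :
    ∃ D : ℝ, 0 < D ∧ ∀ x y : X, ∃ δ : ℝ≥0, δ ≤ D * dist x y ∧ ∃ σ : ℝ≥0 → X,
      σ 0 = x ∧ σ δ = y ∧ ∀ s t : ℝ≥0, s ≤ t → t ≤ δ → dist (σ s) (σ t) ≤ c * (t - s) := by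
  obtain ⟨D, hD, hconn⟩ := h
  have hc' : (0 : ℝ) < c := hc
  refine ⟨D / c, by positivity, fun x y => ?_⟩
  obtain ⟨T, ⟨hT₀, hT⟩, σ, ⟨C, hC⟩, hσ₀, hσT, hσ⟩ := hconn x y
  lift T to ℝ≥0 using hT₀
  have hcT : (c : ℝ) * ((T / c : ℝ≥0) : ℝ) = T := by
    rw [NNReal.coe_div]
    exact mul_div_cancel₀ (T : ℝ) hc'.ne'
  refine ⟨T / c, ?_, fun t => σ (c * t), by simpa using hσ₀, ?_, fun s t hst ht => ?_⟩
  · rw [NNReal.coe_div, div_mul_eq_mul_div]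
    exact div_le_div_of_nonneg_right hT hc'.le
  · simp only [hcT, hσT]
  · have hst' : (c : ℝ) * s ≤ c * t := mul_le_mul_of_nonneg_left (NNReal.coe_le_coe.2 hst) hc'.le
    have ht' : (c : ℝ) * t ≤ T := by
      rw [← hcT]
      exact mul_le_mul_of_nonneg_left (NNReal.coe_le_coe.2 ht) hc'.le
    have h0 : (0 : ℝ) ≤ c * s := by positivity
    have h := dist_le_integral_of_metricDeriv_le hst' (hC.mono (Icc_subset_Icc h0 ht'))
      (m := fun _ => 1) intervalIntegrable_const
      (hσ.mono fun r hr hrst => ⟨1, hr ⟨h0.trans_lt hrst.1, hrst.2.trans_le ht'⟩, le_rfl⟩)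
    simpa [mul_sub] using h

lemma exists_mem_Adm_joining [TopologicalSpace.SeparableSpace X]
    (hk : Continuous (Function.uncurry k)) {Kmin Kmax : ℝ≥0} (hKmin : 0 < Kmin)
    (hmin : ∀ t x, Kmin ≤ k t x) (hmax : ∀ t x, k t x ≤ Kmax)
    (hconn : HasUnitSpeedConnections X) (x y : X) :
    ∃ γ ∈ Adm k, γ 0 = x ∧ ∃ t, γ t = y := by
  obtain ⟨D, -, h⟩ := hconn.exists_path hKmin
  obtain ⟨δ, -, σ, hσ₀, hσδ, hσ⟩ := h x y
  obtain ⟨γ, hγ, hγ₀, hγδ⟩ := exists_mem_Adm_of_path hk hmin hmax (w := σ) (δ := δ) (b := δ) le_rfl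
    (m := fun _ => Kmin) continuous_const hσ
    (fun s t hs hst ht => by
      have hs' : s = t := le_antisymm hst (ht.trans hs)
      simp [hs'])
    fun r _ _ => NNReal.coe_le_coe.2 (hmin _ _)
  exact ⟨γ, hγ, hγ₀.trans hσ₀, δ, hγδ.trans hσδ⟩

/-- An admissible curve from `β(0)` can be imitated from every nearby point with an arbitrarily
small loss of time. The imitating curve reaches `β(0)` in a small time `δ` and then runs along `β`,
parametrized by `A(t) = ∫₀ᵗ k(r, β(r)) dr`, so as to be at the parameter
`ψ(t) = A(t) - A(δ) exp(L(t - δ))` at time `t`. Since it lags behind `β(t)` by at most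
`η(t) = A(δ) exp(L(t - δ))`, where `η' = L η` and `L` is a Lipschitz constant of `k(t, ·)`, its
speed `k(t, β(t)) - L η(t)` is admissible. -/
lemma exists_mem_Adm_imitating [TopologicalSpace.SeparableSpace X]
    (hk : Continuous (Function.uncurry k)) {Kmin Kmax : ℝ≥0} (hKmin : 0 < Kmin)
    (hmin : ∀ t x, Kmin ≤ k t x) (hmax : ∀ t x, k t x ≤ Kmax)
    (hconn : HasUnitSpeedConnections X) (o : X)
    (hlip : ∀ R : ℝ, 0 < R → ∃ L : ℝ≥0, 0 < L ∧ ∀ t,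
      LipschitzOnWith L (k t) (Metric.closedBall o R))
    {β : C(ℝ≥0, X)} (hβ : β ∈ Adm k) (T : ℝ≥0) {ε : ℝ} (hε : 0 < ε) :
    ∀ᶠ x in 𝓝 (β 0), ∃ γ ∈ Adm k, γ 0 = x ∧ ∃ b : ℝ≥0, (b : ℝ) ≤ T + ε ∧ γ b = β T := by
  wlog hε1 : ε ≤ 1 generalizing ε
  · filter_upwards [this one_pos le_rfl] with x hx
    obtain ⟨γ, hγ, hγ₀, b, hb, hγb⟩ := hx
    exact ⟨γ, hγ, hγ₀, b, by linarith, hγb⟩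
  obtain ⟨D, hD, hpath⟩ := hconn.exists_path hKmin
  have hKmin' : (0 : ℝ) < Kmin := hKmin
  have hKmax' : (0 : ℝ) < Kmax := hKmin'.trans_le ((hmin 0 o).trans (hmax 0 o))
  have hT0 : (0 : ℝ) ≤ T := T.coe_nonneg
  -- `k(t, ·)` is `L`-Lipschitz on a ball that contains `β([0, T + 1])`.
  have hR0 : 0 < dist (β 0) o + Kmax * (T + 1) := by positivity
  obtain ⟨L, hL, hkL⟩ := hlip _ hR0
  have hL' : (0 : ℝ) < L := hL
  have hball : ∀ r : ℝ≥0, (r : ℝ) ≤ T + 1 →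
      β r ∈ Metric.closedBall o (dist (β 0) o + Kmax * (T + 1)) := by
    intro r hr
    have h := dist_le_of_mem_Adm hk hmax hβ (zero_le : 0 ≤ r)
    rw [dist_comm, NNReal.coe_zero, sub_zero] at h
    have h' : (Kmax : ℝ) * r ≤ Kmax * (T + 1) := mul_le_mul_of_nonneg_left hr hKmax'.le
    rw [Metric.mem_closedBall]
    linarith [dist_triangle (β r) (β 0) o]
  let u : ℝ → ℝ := speedAlong k β
  have hu : Continuous u := continuous_speedAlong hk β
  have hui : ∀ s t : ℝ, IntervalIntegrable u volume s t := fun s t => hu.intervalIntegrable s t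
  let A : ℝ → ℝ := fun t => ∫ r in (0 : ℝ)..t, u r
  have hA0 : A 0 = 0 := intervalIntegral.integral_same
  have hAcont : Continuous A := intervalIntegral.continuous_primitive hui 0
  have hAsub : ∀ s t : ℝ, A t - A s = ∫ r in s..t, u r := fun s t =>
    intervalIntegral.integral_interval_sub_left (hui 0 t) (hui 0 s)
  have hAlow : ∀ s t : ℝ, s ≤ t → Kmin * (t - s) ≤ A t - A s := fun s t hst => by
    rw [hAsub]
    exact le_integral_speedAlong hk hmin β hst
  have hAup : ∀ s t : ℝ, s ≤ t → A t - A s ≤ Kmax * (t - s) := fun s t hst => by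
    rw [hAsub]
    exact integral_speedAlong_le hk hmax β hst
  have hAβ : ∀ s t : ℝ≥0, dist (β s) (β t) ≤ |A s - A t| := by
    intro s t
    wlog hst : s ≤ t generalizing s t
    · rw [dist_comm, abs_sub_comm]
      exact this t s (le_of_not_ge hst)
    rw [abs_sub_comm, hAsub]
    exact (dist_le_integral_of_mem_Adm hk hβ hst).trans (le_abs_self _)
  set M : ℝ := Real.exp (L * (T + 1))
  have hM0 : 0 < M := Real.exp_pos _
  -- The delay `δ` is so small that `ψ` is monotone and reaches `A(T)` before the time `T + ε`.
  obtain ⟨δ₀, hδ₀, hδ₀ε, hδ₀₁, hδ₀₂⟩ : ∃ δ₀ : ℝ, 0 < δ₀ ∧ δ₀ ≤ ε ∧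
      Kmax * δ₀ * M ≤ Kmin * ε ∧ L * (Kmax * δ₀ * M) ≤ Kmin := by
    refine ⟨min ε (min (Kmin * ε / (Kmax * M)) (Kmin / (L * (Kmax * M)))), by positivity,
      min_le_left _ _, ?_, ?_⟩
    · have h := (min_le_right ε _).trans (min_le_left (Kmin * ε / (Kmax * M))
        (Kmin / (L * (Kmax * M))))
      rw [le_div_iff₀ (by positivity)] at h
      linarith
    · have h := (min_le_right ε _).trans (min_le_right (Kmin * ε / (Kmax * M))
        (Kmin / (L * (Kmax * M))))
      rw [le_div_iff₀ (by positivity)] at h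
      linarith
  filter_upwards [Metric.ball_mem_nhds (β 0) (show 0 < δ₀ / D by positivity)] with x hx
  obtain ⟨δ, hδ, σ, hσ₀, hσδ, hσ⟩ := hpath x (β 0)
  have hδδ₀ : (δ : ℝ) ≤ δ₀ := by
    have hx' : dist x (β 0) * D < δ₀ := (lt_div_iff₀ hD).1 hx
    linarith
  have hδ0 : (0 : ℝ) ≤ δ := δ.coe_nonneg
  have hAδ0 : 0 ≤ A δ := by
    have h := hAlow 0 δ hδ0
    have h' : (0 : ℝ) ≤ Kmin * (δ - 0) := by rw [sub_zero]; positivity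
    linarith
  have hAδ : A δ ≤ Kmax * δ₀ := by
    have h := hAup 0 δ hδ0
    have h' : (Kmax : ℝ) * δ ≤ Kmax * δ₀ := mul_le_mul_of_nonneg_left hδδ₀ hKmax'.le
    rw [hA0, sub_zero, sub_zero] at h
    exact h.trans h'
  let η : ℝ → ℝ := fun t => A δ * Real.exp (L * (t - δ))
  have hη0 : ∀ t, 0 ≤ η t := fun t => mul_nonneg hAδ0 (Real.exp_pos _).le
  have hη_le : ∀ t : ℝ, t ≤ T + 1 → η t ≤ Kmax * δ₀ * M := by
    intro t ht
    refine mul_le_mul hAδ (Real.exp_le_exp.2 ?_) (Real.exp_pos _).le (by positivity)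
    exact mul_le_mul_of_nonneg_left (by linarith) hL'.le
  have hηcont : Continuous η := by fun_prop
  have hηderiv : ∀ t, HasDerivAt η (L * η t) t := by
    intro t
    have h : HasDerivAt (fun s : ℝ => (L : ℝ) * (s - δ)) (L * 1) t :=
      ((hasDerivAt_id t).sub_const (δ : ℝ)).const_mul (L : ℝ)
    convert! h.exp.const_mul (A δ) using 1
    simp only [η]
    ring
  let q : ℝ → ℝ := fun r => u r - L * η r
  have hq : Continuous q := by fun_prop
  let ψ : ℝ → ℝ := fun t => A t - η t
  have hψcont : Continuous ψ := by fun_prop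
  have hψsub : ∀ s t : ℝ, ψ t - ψ s = ∫ r in s..t, q r := by
    intro s t
    have h := intervalIntegral.integral_eq_sub_of_hasDerivAt (a := s) (b := t)
      (fun r _ => hηderiv r) ((by fun_prop : Continuous fun r => L * η r).intervalIntegrable s t)
    simp only [q]
    rw [intervalIntegral.integral_sub (hui s t)
      ((by fun_prop : Continuous fun r => L * η r).intervalIntegrable s t), h, ← hAsub]
    ring
  have hq0 : ∀ r : ℝ, r ≤ T + 1 → 0 ≤ q r := by
    intro r hr
    have h₁ : (Kmin : ℝ) ≤ u r := NNReal.coe_le_coe.2 (hmin _ _)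
    have h₂ : L * η r ≤ L * (Kmax * δ₀ * M) := mul_le_mul_of_nonneg_left (hη_le r hr) hL'.le
    simp only [q]
    linarith
  have hψmono : ∀ s t : ℝ, s ≤ t → t ≤ T + 1 → ψ s ≤ ψ t := by
    intro s t hst ht
    have h := intervalIntegral.integral_nonneg (μ := volume) hst
      fun r (hr : r ∈ Icc s t) => hq0 r (hr.2.trans ht)
    rw [← hψsub] at h
    linarith
  have hψδ : ψ δ = 0 := by simp [ψ, η]
  have hAT0 : 0 ≤ A T := by
    have h := hAlow 0 T hT0
    have h' : (0 : ℝ) ≤ Kmin * (T - 0) := by rw [sub_zero]; positivity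
    linarith
  obtain ⟨b, ⟨hδb, hbT⟩, hψb⟩ : ∃ b ∈ Icc (δ : ℝ) (T + ε), ψ b = A T := by
    refine intermediate_value_Icc (by linarith) hψcont.continuousOn ⟨hψδ.trans_le hAT0, ?_⟩
    have h₁ := hAlow T (T + ε) (by linarith)
    have h₂ := hη_le (T + ε) (by linarith)
    simp only [ψ]
    linarith
  lift b to ℝ≥0 using hδ0.trans hδb
  have hδb' : δ ≤ b := NNReal.coe_le_coe.1 hδb
  have hφ : ∀ t : ℝ≥0, ∃ p : ℝ≥0, δ ≤ t → t ≤ b → p ≤ T ∧ A p = ψ t := by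
    intro t
    by_cases ht : δ ≤ t ∧ t ≤ b
    · obtain ⟨p, ⟨hp₀, hpT⟩, hp⟩ : ∃ p ∈ Icc (0 : ℝ) T, A p = ψ t := by
        have htb : (t : ℝ) ≤ b := NNReal.coe_le_coe.2 ht.2
        refine intermediate_value_Icc hT0 hAcont.continuousOn ⟨?_, ?_⟩
        · rw [hA0, ← hψδ]
          exact hψmono δ t (NNReal.coe_le_coe.2 ht.1) (by linarith)
        · rw [← hψb]
          exact hψmono t b htb (by linarith)
      exact ⟨⟨p, hp₀⟩, fun _ _ => ⟨hpT, hp⟩⟩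
    · exact ⟨0, fun h₁ h₂ => absurd ⟨h₁, h₂⟩ ht⟩
  choose φ hφ using hφ
  have heq : ∀ s t : ℝ≥0, A s = A t → β s = β t := by
    intro s t hst
    wlog hle : s ≤ t generalizing s t
    · exact (this t s hst.symm (le_of_not_ge hle)).symm
    have h := hAlow s t (NNReal.coe_le_coe.2 hle)
    rw [hst, sub_self] at h
    have h' : (t : ℝ) - s ≤ 0 := nonpos_of_mul_nonpos_right h hKmin'
    rw [le_antisymm hle (NNReal.coe_le_coe.1 (sub_nonpos.1 h'))]
  let w : ℝ≥0 → X := fun t => if t < δ then σ t else β (φ t)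
  have hwσ : ∀ t ≤ δ, w t = σ t := by
    intro t ht
    rcases ht.lt_or_eq with h | rfl
    · exact if_pos h
    · rw [hσδ]
      refine (if_neg (lt_irrefl _)).trans (heq _ _ ?_)
      rw [(hφ t le_rfl hδb').2, hψδ, NNReal.coe_zero, hA0]
  have hwβ : ∀ t, δ ≤ t → w t = β (φ t) := fun t ht => if_neg ht.not_gt
  obtain ⟨γ, hγ, hγ₀, hγb⟩ := exists_mem_Adm_of_path hk hmin hmax (w := w) hδb' hq
    (fun s t hst ht => by
      rw [hwσ t ht, hwσ s (hst.trans ht)]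
      exact hσ s t hst ht)
    (fun s t hs hst ht => by
      rw [hwβ s hs, hwβ t (hs.trans hst), ← hψsub]
      refine (hAβ _ _).trans_eq ?_
      have htb : (t : ℝ) ≤ b := NNReal.coe_le_coe.2 ht
      rw [(hφ s hs (hst.trans ht)).2, (hφ t (hs.trans hst) ht).2, abs_sub_comm, abs_of_nonneg]
      exact sub_nonneg.2 (hψmono s t (NNReal.coe_le_coe.2 hst) (by linarith)))
    (fun r hr hrb => by
      have hrb' : (r : ℝ) ≤ b := NNReal.coe_le_coe.2 hrb
      obtain ⟨hφT, hφψ⟩ := hφ r hr hrb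
      have hφT' : (φ r : ℝ) ≤ T := NNReal.coe_le_coe.2 hφT
      have hdist : dist (β r) (β (φ r)) ≤ η r := by
        refine (hAβ _ _).trans_eq ?_
        rw [hφψ]
        simp only [ψ, sub_sub_cancel, abs_of_nonneg (hη0 _)]
      have hLip := (hkL r).dist_le_mul _ (hball r (by linarith)) _ (hball (φ r) (by linarith))
      rw [NNReal.dist_eq] at hLip
      have h₁ := (le_abs_self _).trans hLip
      have h₂ : (L : ℝ) * dist (β r) (β (φ r)) ≤ L * η r :=
        mul_le_mul_of_nonneg_left hdist hL'.le
      rw [hwβ r hr]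
      simp only [q, u, speedAlong, Real.toNNReal_coe]
      linarith)
  refine ⟨γ, hγ, ?_, b, hbT, ?_⟩
  · rw [hγ₀, hwσ 0 zero_le, hσ₀]
  · rw [hγb, hwβ b hδb']
    exact heq _ _ ((hφ b hδb' le_rfl).2.trans hψb)

end Perturbation

/-! ### Exit times, costs, and the closedness of the set of optimal curves -/

section Costs

variable {X : Type*} [PseudoMetricSpace X] {k : ℝ≥0 → X → ℝ≥0} {Γ : Set X} {g : X → ℝ≥0}

lemma exitTime_zero_le {γ : C(ℝ≥0, X)} {t : ℝ≥0} (ht : γ t ∈ Γ) : exitTime Γ 0 γ ≤ t :=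
  iInf₂_le t (by simpa using ht)

/-- A finite exit time from a closed target is attained. -/
lemma apply_exitTime_zero_mem (hΓ : IsClosed Γ) {γ : C(ℝ≥0, X)} (h : exitTime Γ 0 γ < ∞) :
    γ (exitTime Γ 0 γ).toNNReal ∈ Γ := by
  let S : Set ℝ≥0 := γ ⁻¹' Γ
  obtain ⟨t, ht⟩ : S.Nonempty := by
    obtain ⟨t, ht⟩ := iInf_lt_iff.1 h
    obtain ⟨ht, -⟩ := iInf_lt_iff.1 ht
    rw [add_zero] at ht
    exact ⟨t, ht⟩
  have hmem : sInf S ∈ S := (hΓ.preimage γ.continuous).csInf_mem ⟨t, ht⟩ (OrderBot.bddBelow S)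
  have heq : exitTime Γ 0 γ = (sInf S : ℝ≥0) := by
    refine le_antisymm (exitTime_zero_le hmem) (le_iInf₂ fun s hs => ?_)
    rw [add_zero] at hs
    exact ENNReal.coe_le_coe.2 (csInf_le (OrderBot.bddBelow S) hs)
  rw [heq, ENNReal.toNNReal_coe]
  exact hmem

lemma totalCost_zero_eq {γ : C(ℝ≥0, X)} (h : exitTime Γ 0 γ < ∞) :
    totalCost Γ g 0 γ =
      ((exitTime Γ 0 γ).toNNReal + g (γ (exitTime Γ 0 γ).toNNReal) : ℝ≥0) := by
  rw [totalCost, finalCost, if_neg h.ne, zero_add, ENNReal.coe_add, ENNReal.coe_toNNReal h.ne]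

lemma cost_le_of_le (hk : Continuous (Function.uncurry k)) {Kmax Lg : ℝ≥0}
    (hmax : ∀ t x, k t x ≤ Kmax) (hg : LipschitzOnWith Lg g Γ) {γ : C(ℝ≥0, X)} (hγ : γ ∈ Adm k)
    {s t : ℝ≥0} (hst : s ≤ t) (hs : γ s ∈ Γ) (ht : γ t ∈ Γ) :
    (g (γ s) : ℝ) ≤ g (γ t) + Lg * Kmax * (t - s) := by
  have h₁ := hg.dist_le_mul _ hs _ ht
  rw [NNReal.dist_eq] at h₁
  have h₂ : (Lg : ℝ) * dist (γ s) (γ t) ≤ Lg * (Kmax * (t - s)) :=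
    mul_le_mul_of_nonneg_left (dist_le_of_mem_Adm hk hmax hγ hst) Lg.coe_nonneg
  linarith [le_abs_self ((g (γ s) : ℝ) - g (γ t))]

/-- Since `g` grows along admissible curves more slowly than time, leaving later does not pay. -/
lemma totalCost_zero_le (hk : Continuous (Function.uncurry k)) {Kmax Lg : ℝ≥0}
    (hmax : ∀ t x, k t x ≤ Kmax) (hΓ : IsClosed Γ) (hg : LipschitzOnWith Lg g Γ)
    (hLK : Lg * Kmax < 1) {γ : C(ℝ≥0, X)} (hγ : γ ∈ Adm k) {t : ℝ≥0} (ht : γ t ∈ Γ) :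
    totalCost Γ g 0 γ ≤ (t + g (γ t) : ℝ≥0) := by
  have hle : exitTime Γ 0 γ ≤ t := exitTime_zero_le ht
  have htop : exitTime Γ 0 γ < ∞ := hle.trans_lt ENNReal.coe_lt_top
  rw [totalCost_zero_eq htop, ENNReal.coe_le_coe, ← NNReal.coe_le_coe, NNReal.coe_add,
    NNReal.coe_add]
  have hτ : (exitTime Γ 0 γ).toNNReal ≤ t := ENNReal.toNNReal_mono ENNReal.coe_ne_top hle
  have h := cost_le_of_le hk hmax hg hγ hτ (apply_exitTime_zero_mem hΓ htop) ht
  have hLK' : (Lg : ℝ) * Kmax ≤ 1 := by exact_mod_cast hLK.le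
  have hτ' : (0 : ℝ) ≤ t - (exitTime Γ 0 γ).toNNReal := sub_nonneg.2 (NNReal.coe_le_coe.2 hτ)
  nlinarith [mul_nonneg (sub_nonneg.2 hLK') hτ']

/-- The set of optimal curves, over all initial points, is closed. Along curves that converge to
`γ`, the exit times converge to some `T`, and `γ` stays at a point of `Γ` from `T` on. Imitating
an arbitrary competitor from the nearby initial points shows that `T + g(γ(T))` is at most the cost
of the competitor; the competitor `γ` itself excludes an exit before `T`. -/
lemma isClosed_setOf_mem_Opt [T2Space X] [SecondCountableTopology X]
    (hk : Continuous (Function.uncurry k)) {Kmin Kmax Lg : ℝ≥0} (hKmin : 0 < Kmin)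
    (hmin : ∀ t x, Kmin ≤ k t x) (hmax : ∀ t x, k t x ≤ Kmax)
    (hconn : HasUnitSpeedConnections X) (o : X)
    (hlip : ∀ R : ℝ, 0 < R → ∃ L : ℝ≥0, 0 < L ∧ ∀ t,
      LipschitzOnWith L (k t) (Metric.closedBall o R))
    (hΓne : Γ.Nonempty) (hΓ : IsClosed Γ) (hg : LipschitzOnWith Lg g Γ) (hLK : Lg * Kmax < 1) :
    IsClosed {γ : C(ℝ≥0, X) | γ ∈ Opt Γ k g 0 (γ 0)} := by
  rw [isClosed_iff_ultrafilter]
  intro γ U hUγ hU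
  have hU' : ∀ᶠ α in (U : Filter C(ℝ≥0, X)), α ∈ Opt Γ k g 0 (α 0) := hU
  have hγ : γ ∈ Adm k :=
    (isClosed_Adm hk hmax).mem_of_tendsto hUγ (hU'.mono fun α hα => hα.1)
  have heval : ∀ {f : C(ℝ≥0, X) → ℝ≥0} {t : ℝ≥0}, Tendsto f U (𝓝 t) →
      Tendsto (fun α : C(ℝ≥0, X) => α (f α)) U (𝓝 (γ t)) := fun {f t} hf =>
    (continuous_eval (F := C(ℝ≥0, X)).tendsto (γ, t)).comp (Tendsto.prodMk_nhds hUγ hf)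
  -- Upper semicontinuity of the value: no competitor for `γ` is much cheaper than the optimal
  -- curves `α` near `γ`.
  have hle : ∀ β ∈ Adm k, β 0 = γ 0 → ∀ t, β t ∈ Γ → ∀ ε : ℝ, 0 < ε →
      ∀ᶠ α in (U : Filter C(ℝ≥0, X)),
        ((exitTime Γ 0 α).toNNReal + g (α (exitTime Γ 0 α).toNNReal) : ℝ) ≤
          t + g (β t) + ε := by
    intro β hβ hβ₀ t ht ε hε
    have hnear := exists_mem_Adm_imitating hk hKmin hmin hmax hconn o hlip hβ t hε
    rw [hβ₀] at hnear
    filter_upwards [(heval (tendsto_const_nhds (x := 0))).eventually hnear, hU'] with α hα hαopt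
    obtain ⟨β', hβ', hβ'₀, b, hb, hβ'b⟩ := hα
    have h := (hαopt.2.2.2.2 ⟨hβ', hβ'₀⟩ : totalCost Γ g 0 α ≤ totalCost Γ g 0 β').trans
      (totalCost_zero_le hk hmax hΓ hg hLK hβ' (t := b) (hβ'b ▸ ht))
    rw [totalCost_zero_eq hαopt.2.2.1, ENNReal.coe_le_coe, ← NNReal.coe_le_coe, NNReal.coe_add,
      NNReal.coe_add, hβ'b] at h
    linarith
  obtain ⟨y, hy⟩ := hΓne
  obtain ⟨β₀, hβ₀, hβ₀γ, t₀, hβ₀y⟩ := exists_mem_Adm_joining hk hKmin hmin hmax hconn (γ 0) y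
  obtain ⟨T, -, hT⟩ : ∃ T ∈ Icc (0 : ℝ≥0) (t₀ + g y + 1),
      Tendsto (fun α : C(ℝ≥0, X) => (exitTime Γ 0 α).toNNReal) U (𝓝 T) := by
    refine isCompact_Icc.ultrafilter_le_nhds'
      (U.map fun α : C(ℝ≥0, X) => (exitTime Γ 0 α).toNNReal) ?_
    refine Ultrafilter.mem_map.2 ?_
    filter_upwards [hle β₀ hβ₀ hβ₀γ t₀ (by rwa [hβ₀y]) 1 one_pos] with α hα
    refine ⟨zero_le, ?_⟩
    rw [hβ₀y] at hα
    rw [← NNReal.coe_le_coe, NNReal.coe_add, NNReal.coe_add, NNReal.coe_one]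
    linarith [(g (α (exitTime Γ 0 α).toNNReal)).coe_nonneg]
  have hmem : ∀ᶠ α in (U : Filter C(ℝ≥0, X)), α (exitTime Γ 0 α).toNNReal ∈ Γ :=
    hU'.mono fun α hα => apply_exitTime_zero_mem hΓ hα.2.2.1
  have hTΓ : γ T ∈ Γ := hΓ.mem_of_tendsto (heval hT) hmem
  have hgT : Tendsto (fun α : C(ℝ≥0, X) => g (α (exitTime Γ 0 α).toNNReal)) U (𝓝 (g (γ T))) :=
    (hg.continuousOn (γ T) hTΓ).tendsto.comp
      (tendsto_nhdsWithin_iff.2 ⟨heval hT, hmem⟩)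
  have hcost : ∀ β ∈ Adm k, β 0 = γ 0 → ∀ t, β t ∈ Γ → (T + g (γ T) : ℝ) ≤ t + g (β t) := by
    intro β hβ hβγ t ht
    refine le_of_forall_pos_le_add fun ε hε => ?_
    exact le_of_tendsto ((NNReal.tendsto_coe.2 hT).add (NNReal.tendsto_coe.2 hgT))
      (hle β hβ hβγ t ht ε hε)
  have hfin : exitTime Γ 0 γ < ∞ := (exitTime_zero_le hTΓ).trans_lt ENNReal.coe_lt_top
  have hτT : (exitTime Γ 0 γ).toNNReal = T := by
    have hτΓ := apply_exitTime_zero_mem hΓ hfin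
    have hτ : (exitTime Γ 0 γ).toNNReal ≤ T :=
      ENNReal.toNNReal_mono ENNReal.coe_ne_top (exitTime_zero_le hTΓ)
    refine hτ.antisymm ?_
    have h₁ := cost_le_of_le hk hmax hg hγ hτ hτΓ hTΓ
    have h₂ := hcost γ hγ rfl _ hτΓ
    have hLK' : (Lg : ℝ) * Kmax < 1 := by exact_mod_cast hLK
    rw [← NNReal.coe_le_coe]
    by_contra! hlt
    nlinarith [mul_pos (sub_pos.2 hLK') (sub_pos.2 hlt)]
  refine ⟨hγ, fun t ht => by rw [nonpos_iff_eq_zero.1 ht], hfin, ?_, ?_⟩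
  · rw [zero_add, hτT]
    refine fun t ht => ⟨?_, hTΓ⟩
    rcases ht.eq_or_lt with rfl | ht
    · rfl
    refine tendsto_nhds_unique (heval (tendsto_const_nhds (x := t))) ((heval hT).congr' ?_)
    filter_upwards [hT.eventually (gt_mem_nhds ht), hU'] with α hα hαopt
    have h := (hαopt.2.2.2.1 t (by rw [zero_add]; exact hα.le)).1
    rw [zero_add] at h
    exact h.symm
  · rintro β ⟨hβ, hβγ⟩
    change totalCost Γ g 0 γ ≤ totalCost Γ g 0 β
    by_cases hβfin : exitTime Γ 0 β < ∞
    · rw [totalCost_zero_eq hfin, totalCost_zero_eq hβfin, hτT, ENNReal.coe_le_coe,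
        ← NNReal.coe_le_coe, NNReal.coe_add, NNReal.coe_add]
      exact hcost β hβ hβγ _ (apply_exitTime_zero_mem hΓ hβfin)
    · rw [totalCost.eq_1 Γ g 0 β, not_lt_top_iff.1 hβfin, top_add]
      exact le_top

end Costs

/-! ### The speed bound induced by a distribution of curves -/

/-- By dominated convergence, the law of `γ(t)` depends continuously on `t`. -/
lemma continuous_evalMap {X : Type*} [MetricSpace X] [MeasurableSpace X] [BorelSpace X]
    (Q : ProbabilityMeasure C(ℝ≥0, X)) : Continuous (evalMap Q) := by
  refine continuous_iff_continuousAt.2 fun t₀ => ?_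
  refine ProbabilityMeasure.tendsto_iff_forall_integral_tendsto.2 fun f => ?_
  have hint : ∀ t, ∫ x, f x ∂(evalMap Q t : Measure X) = ∫ γ, f (γ t) ∂(Q : Measure C(ℝ≥0, X)) :=
    fun t => integral_map (continuous_eval_const t).aemeasurable
      f.continuous.aestronglyMeasurable
  simp only [hint]
  refine (continuous_of_dominated (bound := fun _ => ‖f‖) (fun t => ?_) (fun t => ?_)
    (integrable_const _) ?_).tendsto t₀
  · exact (f.continuous.measurable.comp (continuous_eval_const t).measurable).aestronglyMeasurable
  · exact Eventually.of_forall fun γ => f.norm_coe_le_norm _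
  · exact Eventually.of_forall fun γ => f.continuous.comp γ.continuous

end ExitMFG

theorem corollary4p16 {X : Type*} [MetricSpace X] [MeasurableSpace X] [BorelSpace X]
    -- all closed balls around the base point are compact
    (o : X) (hX : ∀ R : ℝ, 0 < R → IsCompact (Metric.closedBall o R))
    -- the target set
    (Γ : Set X) (hΓne : Γ.Nonempty) (hΓ : IsClosed Γ)
    -- the exit cost; only its values on the target set matter
    (g : X → ℝ≥0) (Lg : ℝ≥0) (hg : LipschitzOnWith Lg g Γ)
    (hconn : ExitMFG.HasUnitSpeedConnections X)
    -- the speed bound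
    (K : ProbabilityMeasure X → X → ℝ≥0)
    (hKcont : Continuous fun p : ProbabilityMeasure X × X => K p.1 p.2)
    (Kmin Kmax : ℝ≥0) (hKmin : 0 < Kmin) (hKmax : 0 < Kmax)
    (hKbd : ∀ (μ : ProbabilityMeasure X) (x : X), K μ x ∈ Icc Kmin Kmax)
    (hKlip : ∀ R : ℝ, 0 < R → ∃ L : ℝ≥0, 0 < L ∧ ∀ μ : ProbabilityMeasure X,
      LipschitzOnWith L (K μ) (Metric.closedBall o R))
    (hLK : Lg * Kmax < 1)
    (m₀ : ProbabilityMeasure X) (Q : ProbabilityMeasure C(ℝ≥0, X)) :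
    ExitMFG.IsWeakEquilibrium Γ K g m₀ Q ↔ ExitMFG.IsStrongEquilibrium Γ K g m₀ Q := by
  have : ProperSpace X := ProperSpace.of_seq_closedBall (tendsto_id (α := ℝ) (x := atTop))
    ((eventually_gt_atTop 0).mono hX)
  have hk : Continuous (Function.uncurry (ExitMFG.inducedSpeed K Q)) :=
    hKcont.comp (((ExitMFG.continuous_evalMap Q).comp continuous_fst).prodMk continuous_snd)
  have hclosed := ExitMFG.isClosed_setOf_mem_Opt hk hKmin (fun t x => (hKbd _ x).1)
    (fun t x => (hKbd _ x).2) hconn o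
    (fun R hR => (hKlip R hR).imp fun L hL => ⟨hL.1, fun t => hL.2 _⟩) hΓne hΓ hg hLK
  refine and_congr_right fun _ => ⟨fun h γ hγ => ?_, fun h => ?_⟩
  · exact Measure.support_subset_of_isClosed hclosed h hγ
  · filter_upwards [(Measure.support_mem_ae : _ ∈ ae (Q : Measure C(ℝ≥0, X)))] with γ hγ
    exact h γ hγ
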